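/- **Setting.** There are $N\ge 2$ customers with electric vehicles and $T$ time steps of length $\Delta>0$; $\boldsymbol\eta\in\mathbb R^T$ is the price profile. The distribution feeder is a tree on nodes $0,\dots,k$ with root $0$ and line set $\mathcal E$; each node $i$ carries a set of phases $\Phi^i\subseteq\{\mathfrak a,\mathfrak b,\mathfrak c\}$ (all three at the root), each line $e=(ij)$ a set of phases $\Phi^{e}\subseteq\Phi^i\cap\Phi^j$ and complex impedances $z^{e,\phi\psi}=r^{e,\phi\psi}+\mathfrak i x^{e,\phi\psi}$. Let $\mathcal K=\{(i:\phi): i\ne 0,\ \phi\in\Phi^i\}$ be the set of supply points and $K=|\mathcal K|$. For $(i:\phi),(j:\psi)\in\mathcal K$ let $Z^{ij,\phi\psi}$ be the sum of $z^{e,\phi\psi}$ over the lines $e$ common to the paths from $0$ to $i$ and from $0$ to $j$ with $\phi,\psi\in\Phi^e$. With $\omega=e^{-2\pi\mathfrak i/3}$ and phases numbered $[[\mathfrak a]]=0,[[\mathfrak b]]=1,[[\mathfrak c]]=2$, let $$[R]_{(i:\phi),(j:\psi)}=2\,\mathrm{Re}\big(\overline{Z^{ij,\phi\psi}}\,\omega^{[[\phi]]-[[\psi]]}\big),\qquad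 [X]_{(i:\phi),(j:\psi)}=-2\,\mathrm{Im}\big(\overline{Z^{ij,\phi\psi}}\,\omega^{[[\phi]]-[[\psi]]}\big).$$ Each customer is connected to one supply point; $\Theta\in\{0,1\}^{K\times N}$ is the incidence matrix, and $D_n,E_n\in\mathbb R^K$ are the $n$-th columns of $D=-R\Theta$, $E=-X\Theta$. Given non-EV loads $\widetilde{\mathbf P}(t),\widetilde{\mathbf Q}(t)\in\mathbb R^K$ and a root voltage $v^0\in\mathbb R$, let $\widetilde{\mathbf V}(t)=v^0\mathbf 1-R\widetilde{\mathbf P}(t)-X\widetilde{\mathbf Q}(t)$, stacked over $t=1,\dots,T$ to $\widetilde{\mathbf V}\in\mathbb R^{KT}$. Given voltage limits $\underline{\mathbf v},\overline{\mathbf v}\in\mathbb R^K$, let $\underline{\mathbf V},\overline{\mathbf V}\in\mathbb R^{KT}$ be their $T$-fold stackings. Let $\overline D_n,\overline E_n\in\mathbb R^{KT\times T}$ be the direct sums of $T$ copies of $D_n$, $E_n$, and $$\Gamma_n=\begin{bmatrix}\overline D_n\\-\overline D_n\end{bmatrix},\quad \Xi_n=\begin{bmatrix}\overline E_n\\-\overline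 E_n\end{bmatrix},\quad \Psi_n=[\Gamma_n\ \ \Xi_n\ \ I],\quad \mathbf w=\begin{bmatrix}\overline{\mathbf V}-\widetilde{\mathbf V}\\-\underline{\mathbf V}+\widetilde{\mathbf V}\end{bmatrix}\in\mathbb R^{2KT}.$$ Vehicle $n$ has arrival and departure indices $a_n,d_n\in\mathbb Z_{\ge 0}$, inverter capacity $\overline s_n$, initial, target, minimal and maximal state of charge $\hat\sigma_n,\sigma_n^*,\underline\sigma_n,\overline\sigma_n$, charge rate limits $\underline p_n,\overline p_n$ and regularization parameter $\kappa_n$ (all real). Its feasibility set $\mathcal F_n$ consists of all $(\mathbf p,\mathbf q)\in\mathbb R^T\times\mathbb R^T$ such that, for every $t=1,\dots,T$, $$\underline p_n\le p(t)\le\overline p_n,\qquad \frac{\underline\sigma_n-\hat\sigma_n}{\Delta}\le\sum_{j\le t}p(j)\le\frac{\overline\sigma_n-\hat\sigma_n}{\Delta},\qquad p(t)^2+q(t)^2\le\overline s_n^2,$$ $p(t)=q(t)=0$ unless $a_n<t\le d_n$, and $\sum_{j=1}^{T}p(j)\ge(\sigma_n^*-\hat\sigma_n)/\Delta$. The cost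 is $\Omega_n(\mathbf p)=\Delta\,\boldsymbol\eta^{\mathsf T}\mathbf p+\kappa_n\mathbf p^{\mathsf T}\mathbf p$. For $\mathbf u=(\mathbf p,\mathbf q,\mathbf s)\in\mathbb R^{2T+2KT}$ let $f_n(\mathbf u)=\Omega_n(\mathbf p)$ if $(\mathbf p,\mathbf q)\in\mathcal F_n$ and $\mathbf s\ge\mathbf 0$, and $f_n(\mathbf u)=+\infty$ otherwise. Problem $\mathcal P2$ is $$\min_{\mathbf u_1,\dots,\mathbf u_N}\ \sum_{n=1}^N f_n(\mathbf u_n)\quad\text{subject to}\quad \sum_{n=1}^N\Psi_n\mathbf u_n=\mathbf w .$$ Let $\varphi_n(\boldsymbol\lambda)=\sup_{\mathbf u}\big(-f_n(\mathbf u)-\boldsymbol\lambda^{\mathsf T}\Psi_n\mathbf u\big)$ for $\boldsymbol\lambda\in\mathbb R^{2KT}$, with extended real values. Let $\mathbb G$ be a simple undirected graph (the communication network) on the customers, $\mathcal N_n$ the set of neighbours of $n$. Problem $\mathcal P3$ is $$\min_{\boldsymbol\lambda_n,\,\beta_{nm}\in\mathbb R^{2KT}}\ \sum_{n=1}^N\Big(\varphi_n(\boldsymbol\lambda_n)+\tfrac1N\boldsymbol\lambda_n^{\mathsf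 T}\mathbf w\Big)\quad\text{subject to}\quad \boldsymbol\lambda_n=\beta_{nm}=\boldsymbol\lambda_m\ \text{ for all } n \text{ and } m\in\mathcal N_n .$$ Optimal solutions are feasible minimizers with objective value less than $+\infty$. **Algorithm (communication-censored ADMM).** Fix a stepsize $c>0$ and constants $\gamma>0$, $\varepsilon\in(0,1)$. Start with $\boldsymbol\lambda_n^0=\nu_n^0=\widehat{\boldsymbol\lambda}{}_n^0=\mathbf 0$ for all $n$. For $k=1,2,\dots$, every customer $n$ computes $$\boldsymbol\lambda_n^k\in\operatorname*{argmin}_{\boldsymbol\lambda}\Big(\varphi_n(\boldsymbol\lambda)+\tfrac1N\boldsymbol\lambda^{\mathsf T}\mathbf w+\Big\langle\boldsymbol\lambda,\ \nu_n^{k-1}-c\sum_{m\in\mathcal N_n}\big(\widehat{\boldsymbol\lambda}{}_n^{k-1}+\widehat{\boldsymbol\lambda}{}_m^{k-1}\big)\Big\rangle+c\,|\mathcal N_n|\,\|\boldsymbol\lambda\|^2\Big),$$ sets $\widehat{\boldsymbol\lambda}{}_n^k=\boldsymbol\lambda_n^k$ and transmits it to all its neighbours if $\|\widehat{\boldsymbol\lambda}{}_n^{k-1}-\boldsymbol\lambda_n^k\|\ge\gamma\varepsilon^k$,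 sets $\widehat{\boldsymbol\lambda}{}_n^k=\widehat{\boldsymbol\lambda}{}_n^{k-1}$ without transmitting otherwise, and then updates $\nu_n^k=\nu_n^{k-1}+c\sum_{m\in\mathcal N_n}\big(\widehat{\boldsymbol\lambda}{}_n^k-\widehat{\boldsymbol\lambda}{}_m^k\big)$. (Here $\|\cdot\|$ is the Euclidean norm.) **Proposition.** Assume that $\mathbb G$ is connected, that $\mathcal P2$ has an optimal solution, and that the dual optimum is attained, i.e. $\mathcal P3$ has an optimal solution. Then the algorithm can be carried out (every argmin is non-empty), and for every sequence of iterates that it generates there is an optimal solution $(\boldsymbol\lambda_1^*,\dots,\boldsymbol\lambda_N^*)$ of $\mathcal P3$ with $\boldsymbol\lambda_n^k\to\boldsymbol\lambda_n^*$ as $k\to\infty$ for every $n$. -/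

import Mathlib

open scoped Matrix Topology

noncomputable section

namespace EVCharging

/-- The three phases `𝔞, 𝔟, 𝔠`, with the numerals `0, 1, 2`. -/
abbrev Phase := Fin 3

/-- An unbalanced radial distribution feeder: a tree on the nodes `0, …, k` rooted at the feeder
head `0`, the phases present at each node and on each line, and the resistance and reactance of
each line segment (of which only the entries of the phases on the line are ever used). -/
structure Feeder where
  /-- number of nodes other than the root -/
  k : ℕ
  graph : SimpleGraph (Fin (k + 1))
  radial : graph.IsTree
  nodePhases : Fin (k + 1) → Finset Phase
  root_phases : nodePhases 0 = Finset.univ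
  linePhases : Sym2 (Fin (k + 1)) → Finset Phase
  linePhases_subset : ∀ i j, graph.Adj i j → linePhases s(i, j) ⊆ nodePhases i ∩ nodePhases j
  resistance : Sym2 (Fin (k + 1)) → Phase → Phase → ℝ
  reactance : Sym2 (Fin (k + 1)) → Phase → Phase → ℝ

namespace Feeder

variable (𝒢 : Feeder)

/-- The supply points `(i : φ)`, with `i` a node other than the root and `φ` a phase at `i`. -/
abbrev SupplyPoint : Type :=
  {x : Fin (𝒢.k + 1) × Phase // x.1 ≠ 0 ∧ x.2 ∈ 𝒢.nodePhases x.1}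

/-- Complex impedance `z = r + 𝔦 x` of a line segment. -/
def impedance (e : Sym2 (Fin (𝒢.k + 1))) (φ ψ : Phase) : ℂ :=
  (𝒢.resistance e φ ψ : ℂ) + Complex.I * (𝒢.reactance e φ ψ : ℂ)

/-- The edges on the (unique) path from the root to the node `i`. -/
def pathEdges (i : Fin (𝒢.k + 1)) : Set (Sym2 (Fin (𝒢.k + 1))) :=
  {e | ∃ p : 𝒢.graph.Walk 0 i, p.IsPath ∧ e ∈ p.edges}

open Classical in
/-- `Z^{ij,φψ}`: total impedance along the common part of the paths from the root to `i` and
to `j`, over the lines that carry both phases. -/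
def commonImpedance (i j : Fin (𝒢.k + 1)) (φ ψ : Phase) : ℂ :=
  ∑ e with e ∈ 𝒢.pathEdges i ∩ 𝒢.pathEdges j ∧ φ ∈ 𝒢.linePhases e ∧ ψ ∈ 𝒢.linePhases e,
    𝒢.impedance e φ ψ

/-- `ω = exp(-2π𝔦/3)`. -/
def omega : ℂ := Complex.exp (-2 * Real.pi * Complex.I / 3)

/-- `conj(Z^{ij,φψ}) ω^{[[φ]] - [[ψ]]}`. -/
def rotatedImpedance (x y : 𝒢.SupplyPoint) : ℂ :=
  starRingEnd ℂ (𝒢.commonImpedance x.1.1 y.1.1 x.1.2 y.1.2) *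
    omega ^ (((x.1.2 : ℕ) : ℤ) - ((y.1.2 : ℕ) : ℤ))

/-- The matrix `R` of the linearised power flow. -/
def R : Matrix 𝒢.SupplyPoint 𝒢.SupplyPoint ℝ :=
  Matrix.of fun x y => 2 * (𝒢.rotatedImpedance x y).re

/-- The matrix `X` of the linearised power flow. -/
def X : Matrix 𝒢.SupplyPoint 𝒢.SupplyPoint ℝ :=
  Matrix.of fun x y => -2 * (𝒢.rotatedImpedance x y).im

end Feeder

/-- The design parameters of one electric vehicle, with its regularisation parameter. -/
structure Vehicle where
  arrival : ℕ
  departure : ℕ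
  batteryCapacity : ℝ
  inverterCapacity : ℝ
  initialSoC : ℝ
  targetSoC : ℝ
  minSoC : ℝ
  maxSoC : ℝ
  maxRate : ℝ
  minRate : ℝ
  kappa : ℝ

namespace Vehicle

variable {T : ℕ} (v : Vehicle) (Δ : ℝ)

/-- The lower triangular all-ones matrix `M`. -/
def cumulative (T : ℕ) : Matrix (Fin T) (Fin T) ℝ :=
  Matrix.of fun i j => if j ≤ i then 1 else 0

/-- The availability matrix `L`; the element `i` of `Fin T` is the time index `i + 1`. -/
def availability (T : ℕ) : Matrix (Fin T) (Fin T) ℝ :=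
  Matrix.of fun i j =>
    if i = j ∧ v.arrival < (i : ℕ) + 1 ∧ (i : ℕ) + 1 ≤ v.departure then 1 else 0

/-- The feasibility set `ℱ` of power profiles `(p, q)`. -/
def feasible : Set ((Fin T → ℝ) × (Fin T → ℝ)) :=
  {x | (∀ t, v.minRate ≤ x.1 t ∧ x.1 t ≤ v.maxRate) ∧
    (∀ t, (v.minSoC - v.initialSoC) / Δ ≤ (cumulative T *ᵥ x.1) t ∧
      (cumulative T *ᵥ x.1) t ≤ (v.maxSoC - v.initialSoC) / Δ) ∧
    (v.targetSoC - v.initialSoC) / Δ ≤ ∑ t, x.1 t ∧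
    (1 - v.availability T) *ᵥ x.1 = 0 ∧
    (1 - v.availability T) *ᵥ x.2 = 0 ∧
    ∀ t, x.1 t ^ 2 + x.2 t ^ 2 ≤ v.inverterCapacity ^ 2}

/-- The operational cost `Ω(p) = Δ ηᵀp + κ pᵀp`. -/
def cost (η p : Fin T → ℝ) : ℝ := Δ * (η ⬝ᵥ p) + v.kappa * (p ⬝ᵥ p)

end Vehicle

/-- All data of the charging problem with `N` customers and `T` time steps. -/
structure Model (N T : ℕ) where
  /-- length of a time interval -/
  Δ : ℝ
  Δ_pos : 0 < Δ
  vehicle : Fin N → Vehicle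
  /-- electricity prices -/
  η : Fin T → ℝ
  feeder : Feeder
  /-- the supply point to which each customer is connected -/
  location : Fin N → feeder.SupplyPoint
  /-- squared nominal voltage magnitude at the root -/
  v₀ : ℝ
  /-- net real power of the non-EV loads -/
  loadP : Fin T → feeder.SupplyPoint → ℝ
  /-- net reactive power of the non-EV loads -/
  loadQ : Fin T → feeder.SupplyPoint → ℝ
  /-- lower operational limits -/
  vLow : feeder.SupplyPoint → ℝ
  /-- upper operational limits -/
  vHigh : feeder.SupplyPoint → ℝ

namespace Model

variable {N T : ℕ} (M : Model N T)

/-- The connection matrix `Θ`. -/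
def Theta : Matrix M.feeder.SupplyPoint (Fin N) ℝ :=
  Matrix.of fun x n => if M.location n = x then 1 else 0

def D : Matrix M.feeder.SupplyPoint (Fin N) ℝ := -(M.feeder.R * M.Theta)

def E : Matrix M.feeder.SupplyPoint (Fin N) ℝ := -(M.feeder.X * M.Theta)

/-- The baseline voltages `Ṽ(t) = V⁰ - R P̃(t) - X Q̃(t)`. -/
def baseline (t : Fin T) : M.feeder.SupplyPoint → ℝ :=
  (fun _ => M.v₀) - M.feeder.R *ᵥ M.loadP t - M.feeder.X *ᵥ M.loadQ t

/-- Indices of the `KT` voltages over the horizon. -/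
abbrev VoltageIdx : Type := Fin T × M.feeder.SupplyPoint

/-- Indices of the `2KT` voltage constraints: upper limits, then lower limits. -/
abbrev DualIdx : Type := M.VoltageIdx ⊕ M.VoltageIdx

/-- The space `ℝ^{2KT}` with the Euclidean norm. -/
abbrev Dual : Type := EuclideanSpace ℝ M.DualIdx

/-- The direct sum of `T` copies of the column `D_n`. -/
def DBar (n : Fin N) : Matrix M.VoltageIdx (Fin T) ℝ :=
  Matrix.of fun y t => if y.1 = t then M.D y.2 n else 0

/-- The direct sum of `T` copies of the column `E_n`. -/
def EBar (n : Fin N) : Matrix M.VoltageIdx (Fin T) ℝ :=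
  Matrix.of fun y t => if y.1 = t then M.E y.2 n else 0

def Gam (n : Fin N) : Matrix M.DualIdx (Fin T) ℝ := Matrix.fromRows (M.DBar n) (-(M.DBar n))

def Xi (n : Fin N) : Matrix M.DualIdx (Fin T) ℝ := Matrix.fromRows (M.EBar n) (-(M.EBar n))

/-- `w = (V_high - Ṽ, -V_low + Ṽ)`. -/
def w : M.Dual :=
  WithLp.toLp 2 (Sum.elim (fun y => M.vHigh y.2 - M.baseline y.1 y.2)
    (fun y => -M.vLow y.2 + M.baseline y.1 y.2))

/-- The local decision vectors `u = (p, q, s)`, with `s` the slack. -/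
abbrev Decision : Type := (Fin T → ℝ) × (Fin T → ℝ) × (M.DualIdx → ℝ)

/-- `Ψ_n u = Γ_n p + Ξ_n q + s`. -/
def Psi (n : Fin N) (u : M.Decision) : M.Dual :=
  WithLp.toLp 2 (M.Gam n *ᵥ u.1 + M.Xi n *ᵥ u.2.1 + u.2.2)

/-- The set `𝒰_n`: feasible power profiles and non-negative slacks. -/
def localSet (n : Fin N) : Set M.Decision :=
  {u | (u.1, u.2.1) ∈ (M.vehicle n).feasible M.Δ ∧ 0 ≤ u.2.2}

open Classical in
/-- `f_n`: the operational cost plus the indicator function of `𝒰_n`. -/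
def f (n : Fin N) (u : M.Decision) : EReal :=
  if u ∈ M.localSet n then (((M.vehicle n).cost M.Δ M.η u.1 : ℝ) : EReal) else ⊤

/-- The objective of the problem `𝒫2`. -/
def objP2 (u : Fin N → M.Decision) : EReal := ∑ n, M.f n (u n)

/-- The coupling constraint of `𝒫2`. -/
def FeasibleP2 (u : Fin N → M.Decision) : Prop := ∑ n, M.Psi n (u n) = M.w

/-- `u` is an optimal solution of `𝒫2` (with finite objective). -/
def IsOptimalP2 (u : Fin N → M.Decision) : Prop :=
  M.FeasibleP2 u ∧ M.objP2 u < ⊤ ∧ ∀ u', M.FeasibleP2 u' → M.objP2 u ≤ M.objP2 u'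

/-- `φ_n(l) = max_u (-f_n(u) - lᵀ Ψ_n u)`, with values in the extended reals. -/
def phi (n : Fin N) (l : M.Dual) : EReal :=
  ⨆ u : M.Decision, (-M.f n u - ((inner ℝ l (M.Psi n u) : ℝ) : EReal))

/-- The local cost `φ_n(l) + lᵀw / N`. -/
def localCost (n : Fin N) (l : M.Dual) : EReal :=
  M.phi n l + ((1 / (N : ℝ) * inner ℝ l M.w : ℝ) : EReal)

/-- The objective of the problem `𝒫3`. -/
def objP3 (l : Fin N → M.Dual) : EReal := ∑ n, M.localCost n (l n)

variable (G : SimpleGraph (Fin N))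

/-- The consensus constraints of `𝒫3`; `β n m` is used only for neighbours `m` of `n`. -/
def FeasibleP3 (l : Fin N → M.Dual) (β : Fin N → Fin N → M.Dual) : Prop :=
  ∀ n m, G.Adj n m → l n = β n m ∧ l m = β n m

/-- `l` is, with suitable auxiliary variables `β`, an optimal solution of `𝒫3` (with finite
objective). -/
def IsOptimalP3 (l : Fin N → M.Dual) : Prop :=
  (∃ β, M.FeasibleP3 G l β) ∧ M.objP3 l < ⊤ ∧
    ∀ l' β', M.FeasibleP3 G l' β' → M.objP3 l ≤ M.objP3 l'

/-- The censoring function `H(k, ξ) = ‖ξ‖ - γ ε^k`. -/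
def censor (γ ε : ℝ) (k : ℕ) (ξ : M.Dual) : ℝ := ‖ξ‖ - γ * ε ^ k

variable [DecidableRel G.Adj]

/-- The function of `l` that customer `n` minimises in an iteration, given its dual variable
`ν` and the last broadcasts `hat`. -/
def updateObjective (c : ℝ) (ν : M.Dual) (hat : Fin N → M.Dual) (n : Fin N) (l : M.Dual) : EReal :=
  M.localCost n l +
    ((inner ℝ l (ν - c • ∑ m ∈ G.neighborFinset n, (hat n + hat m)) +
      c * (G.degree n : ℝ) * ‖l‖ ^ 2 : ℝ) : EReal)

/-- The sequences `lam k n`, `nu k n`, `hat k n` (local variable, dual variable and last broadcast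
of customer `n` after `k` iterations) are generated by the communication-censored ADMM with
stepsize `c` and censoring thresholds `γ ε^k`. A broadcast reaches all neighbours, so `hat k m` is
also the state variable for `m` stored by each neighbour of `m`. -/
structure IsCCADMM (c γ ε : ℝ) (lam nu hat : ℕ → Fin N → M.Dual) : Prop where
  lam_zero : ∀ n, lam 0 n = 0
  nu_zero : ∀ n, nu 0 n = 0
  hat_zero : ∀ n, hat 0 n = 0
  lam_succ : ∀ k n,
    IsMinOn (M.updateObjective G c (nu k n) (hat k) n) Set.univ (lam (k + 1) n)
  hat_succ : ∀ k n, hat (k + 1) n =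
    if 0 ≤ M.censor γ ε (k + 1) (hat k n - lam (k + 1) n) then lam (k + 1) n else hat k n
  nu_succ : ∀ k n, nu (k + 1) n =
    nu k n + c • ∑ m ∈ G.neighborFinset n, (hat (k + 1) n - hat (k + 1) m)

end Model

end EVCharging

end

/-! Maximising over the slacks `s ≥ 0` makes `φ_n` equal to `⊤` off the non-negative orthant and
equal to `value n` on it. The latter is a supremum of affine functions of the multiplier over a
non-empty bounded set of power profiles, so it is convex, finite and continuous on the whole space.
Solvability of `𝒫2` supplies the non-emptiness. Since `𝔾` is connected, `𝒫3` becomes the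
minimisation of a continuous convex `g` over a product `S` of orthants subject to `B x = 0`, where
`B` is a scaled signed incidence map.

Let `U` be the unsigned incidence map, let `x` stack the `lam k n`, and let `e = hat - lam` be the
censoring error. Since `Bᵀ B + Uᵀ U` is `2c` times the degree matrix, the local optimality
conditions add up to one step of a proximal method of multipliers with proximal term built from `U`,
perturbed by `e` (`isStep_of_local`). Its multiplier `a` lives on the edges, and `nu` is `Bᵀ a`.
Censoring bounds `e` by a geometric sequence, so the errors are summable.

Testing a step against a KKT pair `(y, b)` shows that `(a, U x)` is quasi-Fejér monotone with
respect to `(b, U y)` (`IsStep.inner_le`). Hence distances to such points converge and increments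
vanish, which gives `B x → 0`. As `(B, U)` is injective, `x` is bounded; a cluster point of `(x, a)`
is again a KKT pair, and the Fejér property relative to it upgrades subsequential convergence to
convergence (`exists_tendsto_of_isStep`). The first KKT pair comes from an optimum of `𝒫3` by a
separation argument (`exists_isKKT_of_isMinOn`). -/

namespace EVCharging

open Filter

/-! ### Quasi-Fejér sequences with summable errors -/

section Fejer

variable {P : Type*} [NormedAddCommGroup P] [InnerProductSpace ℝ P]

theorem norm_sq_step {p p' q d d₀ : P} (hd : ‖d₀‖ ≤ ‖d‖)
    (h : inner ℝ (p' - q) (p' - p) ≤ inner ℝ (p' - q) d + inner ℝ d₀ (p' - p)) :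
    ‖p' - q‖ ^ 2 + 1 / 2 * ‖p' - p‖ ^ 2 ≤ ‖p - q‖ ^ 2 + 2 * ‖p' - q‖ * ‖d‖ + 2 * ‖d‖ ^ 2 := by
  have h1 : p - q = (p' - q) - (p' - p) := by abel
  have h2 := norm_sub_sq_real (p' - q) (p' - p)
  rw [← h1] at h2
  have h3 := real_inner_le_norm (p' - q) d
  have h4 := real_inner_le_norm d₀ (p' - p)
  have h5 : ‖d₀‖ * ‖p' - p‖ ≤ ‖d‖ * ‖p' - p‖ := by gcongr
  -- Young's inequality `2‖d‖‖p' - p‖ ≤ 2‖d‖² + ½‖p' - p‖²` leaves half of the squared increment on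
  -- the left.
  nlinarith [sq_nonneg (‖p' - p‖ - 2 * ‖d‖)]

/-- Sequences that are quasi-Fejér monotone with respect to `q`, with summable errors. -/
theorem exists_tendsto_norm_of_inner_le {p d d₀ : ℕ → P} {q : P} (hd : ∀ k, ‖d₀ k‖ ≤ ‖d k‖)
    (hs : Summable fun k => ‖d k‖)
    (h : ∀ k, inner ℝ (p (k + 1) - q) (p (k + 1) - p k) ≤
      inner ℝ (p (k + 1) - q) (d k) + inner ℝ (d₀ k) (p (k + 1) - p k)) :
    ∃ l, Tendsto (fun k => ‖p k - q‖) atTop (𝓝 l) := by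
  have hstep : ∀ k, ‖p (k + 1) - q‖ ≤ ‖p k - q‖ + 3 * ‖d k‖ := by
    intro k
    have h1 := norm_sq_step (hd k) (h k)
    -- Completing the square absorbs the term linear in `‖p (k + 1) - q‖`; the constant 3 of `hstep`
    -- is the sum of the two shifts 1 and 2.
    have h2 : (‖p (k + 1) - q‖ - ‖d k‖) ^ 2 ≤ (‖p k - q‖ + 2 * ‖d k‖) ^ 2 := by
      nlinarith [sq_nonneg ‖p (k + 1) - p k‖, norm_nonneg (p k - q), norm_nonneg (d k),
        mul_nonneg (norm_nonneg (p k - q)) (norm_nonneg (d k)), sq_nonneg ‖d k‖]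
    have h3 := abs_le_of_sq_le_sq h2 (add_nonneg (norm_nonneg _) (mul_nonneg zero_le_two (norm_nonneg _)))
    linarith [(abs_le.1 h3).2]
  have hanti : Antitone fun k => ‖p k - q‖ - 3 * ∑ j ∈ Finset.range k, ‖d j‖ := by
    refine antitone_nat_of_succ_le fun k => ?_
    rw [Finset.sum_range_succ]
    linarith [hstep k]
  have hbdd : BddBelow (Set.range fun k => ‖p k - q‖ - 3 * ∑ j ∈ Finset.range k, ‖d j‖) := by
    refine ⟨-(3 * ∑' j, ‖d j‖), ?_⟩
    rintro _ ⟨k, rfl⟩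
    have := hs.sum_le_tsum (Finset.range k) fun _ _ => norm_nonneg _
    simp only
    linarith [norm_nonneg (p k - q)]
  refine ⟨_, ((tendsto_atTop_ciInf hanti hbdd).add
    (hs.hasSum.tendsto_sum_nat.const_mul 3)).congr fun k => ?_⟩
  ring

/-- The squared increment is bounded by a difference of consecutive squared distances, which
vanishes because the distances converge, plus error terms that vanish by summability. -/
theorem tendsto_sub_of_inner_le {p d d₀ : ℕ → P} {q : P} (hd : ∀ k, ‖d₀ k‖ ≤ ‖d k‖)
    (hs : Summable fun k => ‖d k‖)
    (h : ∀ k, inner ℝ (p (k + 1) - q) (p (k + 1) - p k) ≤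
      inner ℝ (p (k + 1) - q) (d k) + inner ℝ (d₀ k) (p (k + 1) - p k)) :
    Tendsto (fun k => p (k + 1) - p k) atTop (𝓝 0) := by
  obtain ⟨l, hl⟩ := exists_tendsto_norm_of_inner_le hd hs h
  have hl' := hl.comp (tendsto_add_atTop_nat 1)
  have h0 := hs.tendsto_atTop_zero
  have hb : Tendsto (fun k => 2 * (‖p k - q‖ ^ 2 - ‖p (k + 1) - q‖ ^ 2 +
      2 * ‖p (k + 1) - q‖ * ‖d k‖ + 2 * ‖d k‖ ^ 2)) atTop (𝓝 0) := by
    have := (((hl.pow 2).sub (hl'.pow 2)).add ((hl'.const_mul 2).mul h0)).add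
      ((h0.pow 2).const_mul 2)
    simpa using this.const_mul 2
  have hsq : Tendsto (fun k => ‖p (k + 1) - p k‖ ^ 2) atTop (𝓝 0) :=
    squeeze_zero (fun k => by positivity)
      (fun k => by linarith [norm_sq_step (hd k) (h k)]) hb
  rw [tendsto_zero_iff_norm_tendsto_zero]
  simpa using hsq.sqrt

end Fejer

/-! ### Convergence of an inexact proximal method of multipliers -/

section InexactADMM

variable {H F F' : Type*} [NormedAddCommGroup H] [InnerProductSpace ℝ H]
  [NormedAddCommGroup F] [InnerProductSpace ℝ F] [NormedAddCommGroup F'] [InnerProductSpace ℝ F']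

/-- Karush–Kuhn–Tucker pairs of the problem of minimising `g` over `S` subject to `B x = 0`. -/
def IsKKT (g : H → ℝ) (S : Set H) (B : H →L[ℝ] F) (x : H) (a : F) : Prop :=
  x ∈ S ∧ B x = 0 ∧ ∀ y ∈ S, g x - inner ℝ a (B y) ≤ g y

/-- The variational inequality satisfied by an inexact step of the method of multipliers. -/
def IsStep (g : H → ℝ) (S : Set H) (B : H →L[ℝ] F) (U : H →L[ℝ] F') (x e x' e' : H) (a' : F) :
    Prop :=
  x' ∈ S ∧ ∀ y ∈ S, g x' - inner ℝ a' (B (y - x')) - inner ℝ (U (x' - x - e)) (U (y - x')) +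
    inner ℝ (B e') (B (y - x')) ≤ g y

/-- Adding the step inequality tested at `y` to the KKT inequality tested at `x'` cancels `g`.
Substituting `B x' = a' - a - B e'` then leaves a surplus `‖B e'‖²`, which has the favourable sign
and is dropped. -/
theorem IsStep.inner_le {g : H → ℝ} {S : Set H} {B : H →L[ℝ] F} {U : H →L[ℝ] F'}
    {x e x' e' y : H} {a a' b : F} (h : IsStep g S B U x e x' e' a')
    (ha : a' = a + B (x' + e')) (hy : IsKKT g S B y b) :
    (inner ℝ (WithLp.toLp 2 (a', U x') - WithLp.toLp 2 (b, U y))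
      (WithLp.toLp 2 (a', U x') - WithLp.toLp 2 (a, U x)) : ℝ) ≤
    inner ℝ (WithLp.toLp 2 (a', U x') - WithLp.toLp 2 (b, U y)) (WithLp.toLp 2 (B e', U e)) +
    inner ℝ (WithLp.toLp 2 (B e', (0 : F')))
      (WithLp.toLp 2 (a', U x') - WithLp.toLp 2 (a, U x)) := by
  have h1 := h.2 y hy.1
  have h2 := hy.2.2 x' h.1
  have hB : B x' = a' - a - B e' := by rw [ha, map_add]; abel
  simp only [WithLp.prod_inner_apply, map_sub, hy.2.1, hB,
    inner_sub_left, inner_sub_right, inner_zero_left, inner_zero_right] at h1 h2 ⊢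
  have e1 := real_inner_self_nonneg (x := B e')
  have e2 := real_inner_comm (U x') (U x)
  have e3 := real_inner_comm (U x') (U y)
  have e4 := real_inner_comm (U x) (U y)
  have e5 := real_inner_comm (U x') (U e)
  have e6 := real_inner_comm (U y) (U e)
  have e7 := real_inner_comm a' (B e')
  have e8 := real_inner_comm a (B e')
  linarith

/-- Only `(a, U x)` is Fejér monotone; `x` itself is controlled through `B x → 0` and the
injectivity of `(B, U)`, expressed by `hBU`. This is needed twice: for boundedness, and for the
final passage from `U x → U y` to `x → y`. -/
theorem exists_tendsto_of_isStep [FiniteDimensional ℝ H] [FiniteDimensional ℝ F]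
    {g : H → ℝ} (hg : Continuous g) {S : Set H} (hS : IsClosed S)
    {B : H →L[ℝ] F} {U : H →L[ℝ] F'} {K : NNReal}
    (hBU : AntilipschitzWith K fun x => (B x, U x))
    {x e : ℕ → H} {a : ℕ → F} (he : Summable fun k => ‖e k‖)
    (ha : ∀ k, a (k + 1) = a k + B (x (k + 1) + e (k + 1)))
    (hstep : ∀ k, IsStep g S B U (x k) (e k) (x (k + 1)) (e (k + 1)) (a (k + 1)))
    (hK : ∃ y b, IsKKT g S B y b) :
    ∃ y b, IsKKT g S B y b ∧ Tendsto x atTop (𝓝 y) := by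
  set p : ℕ → WithLp 2 (F × F') := fun k => WithLp.toLp 2 (a k, U (x k)) with hp
  set d : ℕ → WithLp 2 (F × F') := fun k => WithLp.toLp 2 (B (e (k + 1)), U (e k)) with hd
  set d₀ : ℕ → WithLp 2 (F × F') := fun k => WithLp.toLp 2 (B (e (k + 1)), 0) with hd₀
  have hdd : ∀ k, ‖d₀ k‖ ≤ ‖d k‖ := by
    intro k
    rw [WithLp.prod_norm_eq_of_L2, WithLp.prod_norm_eq_of_L2]
    apply Real.sqrt_le_sqrt
    simp [hd, hd₀]
  have hds : Summable fun k => ‖d k‖ := by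
    refine Summable.of_nonneg_of_le (fun _ => norm_nonneg _) (fun k => ?_)
      ((((summable_nat_add_iff 1).2 he).mul_left ‖B‖).add (he.mul_left ‖U‖))
    have hsum : d k = WithLp.toLp 2 (B (e (k + 1)), 0) + WithLp.toLp 2 (0, U (e k)) := by
      simp [hd, ← WithLp.toLp_add]
    rw [hsum]
    refine (norm_add_le _ _).trans (add_le_add ?_ ?_)
    · rw [WithLp.norm_toLp_fst]; exact B.le_opNorm _
    · rw [WithLp.norm_toLp_snd]; exact U.le_opNorm _
  have hle : ∀ {y b}, IsKKT g S B y b → ∀ k,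
      inner ℝ (p (k + 1) - WithLp.toLp 2 (b, U y)) (p (k + 1) - p k) ≤
      inner ℝ (p (k + 1) - WithLp.toLp 2 (b, U y)) (d k) + inner ℝ (d₀ k) (p (k + 1) - p k) :=
    fun h k => (hstep k).inner_le (ha k) h
  obtain ⟨y₀, b₀, h₀⟩ := hK
  obtain ⟨l₀, hl₀⟩ := exists_tendsto_norm_of_inner_le hdd hds (hle h₀)
  have hpp := tendsto_sub_of_inner_le hdd hds (hle h₀)
  have he0 : Tendsto e atTop (𝓝 0) := tendsto_zero_iff_norm_tendsto_zero.2 he.tendsto_atTop_zero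
  have hpc : Tendsto (fun k => (a (k + 1) - a k, U (x (k + 1)) - U (x k))) atTop (𝓝 (0, 0)) := by
    have := (WithLp.prod_continuous_ofLp 2 F F').continuousAt.tendsto.comp hpp
    simpa [Function.comp_def, hp, Prod.zero_eq_mk] using this
  rw [Prod.tendsto_iff] at hpc
  have hBx1 : Tendsto (fun k => B (x (k + 1))) atTop (𝓝 0) := by
    have h1 : ∀ k, a (k + 1) - a k - B (e (k + 1)) = B (x (k + 1)) := by
      intro k; rw [ha k, map_add]; abel
    have h2 := hpc.1.sub ((B.continuous.tendsto 0).comp (he0.comp (tendsto_add_atTop_nat 1)))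
    simpa [Function.comp_def, h1] using h2
  have hBx : Tendsto (fun k => B (x k)) atTop (𝓝 0) :=
    (tendsto_add_atTop_iff_nat 1).1 hBx1
  obtain ⟨R, hR⟩ := hl₀.bddAbove_range
  have hRa : ∀ k, ‖a k - b₀‖ ≤ R ∧ ‖U (x k) - U y₀‖ ≤ R := by
    intro k
    have h1 : ‖p k - WithLp.toLp 2 (b₀, U y₀)‖ ≤ R := hR ⟨k, rfl⟩
    have h2 := WithLp.norm_fst_le _ (p k - WithLp.toLp 2 (b₀, U y₀))
    have h3 := WithLp.norm_snd_le _ (p k - WithLp.toLp 2 (b₀, U y₀))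
    exact ⟨h2.trans h1, h3.trans h1⟩
  obtain ⟨R', hR'⟩ := hBx.norm.bddAbove_range
  have hxb : ∀ k, dist (x k) y₀ ≤ K * max R' R := by
    intro k
    refine (hBU.le_mul_dist _ _).trans ?_
    rw [Prod.dist_eq]
    refine mul_le_mul_of_nonneg_left (max_le_max ?_ ?_) K.2
    · simpa [h₀.2.1] using hR' ⟨k, rfl⟩
    · simpa [dist_eq_norm] using (hRa k).2
  have hbd : Bornology.IsBounded (Set.range fun k => (x (k + 1), a (k + 1))) := by
    have : Bornology.IsBounded (Metric.closedBall y₀ (K * max R' R) ×ˢ Metric.closedBall b₀ R) :=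
      Metric.isBounded_closedBall.prod Metric.isBounded_closedBall
    refine this.subset ?_
    rintro _ ⟨k, rfl⟩
    exact ⟨hxb _, by simpa [dist_eq_norm] using (hRa (k + 1)).1⟩
  -- The index is shifted by one because a step says nothing about the membership of `x 0` in `S` or
  -- about `a 0`.
  obtain ⟨⟨y, b⟩, -, φ, hφ, hlim⟩ := tendsto_subseq_of_bounded hbd
    (x := fun k => (x (k + 1), a (k + 1))) (fun k => ⟨k, rfl⟩)
  rw [Prod.tendsto_iff] at hlim
  obtain ⟨hlx, hla⟩ := hlim
  simp only [Function.comp_def] at hlx hla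
  have hφt := hφ.tendsto_atTop
  have hyB : B y = 0 :=
    tendsto_nhds_unique ((B.continuous.tendsto y).comp hlx) (hBx1.comp hφt)
  have hy : IsKKT g S B y b := by
    refine ⟨hS.mem_of_tendsto hlx (Eventually.of_forall fun k => (hstep _).1), hyB,
      fun z hz => ?_⟩
    have hBz : Tendsto (fun k => B (z - x (φ k + 1))) atTop (𝓝 (B (z - y))) :=
      (B.continuous.tendsto _).comp (tendsto_const_nhds.sub hlx)
    have hUz : Tendsto (fun k => U (z - x (φ k + 1))) atTop (𝓝 (U (z - y))) :=
      (U.continuous.tendsto _).comp (tendsto_const_nhds.sub hlx)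
    have hUe : Tendsto (fun k => U (x (φ k + 1) - x (φ k) - e (φ k))) atTop (𝓝 0) := by
      have := (hpc.2.comp hφt).sub ((U.continuous.tendsto 0).comp (he0.comp hφt))
      simpa [Function.comp_def] using this
    have hBe : Tendsto (fun k => B (e (φ k + 1))) atTop (𝓝 0) := by
      have := (B.continuous.tendsto 0).comp ((he0.comp (tendsto_add_atTop_nat 1)).comp hφt)
      simpa [Function.comp_def] using this
    have hall := ((((hg.tendsto y).comp hlx).sub (hla.inner hBz)).sub (hUe.inner hUz)).add
      (hBe.inner hBz)
    have := le_of_tendsto hall (Eventually.of_forall fun k => (hstep (φ k)).2 z hz)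
    simpa [hyB] using this
  refine ⟨y, b, hy, ?_⟩
  obtain ⟨l, hl⟩ := exists_tendsto_norm_of_inner_le hdd hds (hle hy)
  have hsub : Tendsto (fun k => ‖p (φ k + 1) - WithLp.toLp 2 (b, U y)‖) atTop (𝓝 0) := by
    have h1 : Tendsto (fun k => WithLp.toLp 2 (a (φ k + 1), U (x (φ k + 1)))) atTop
        (𝓝 (WithLp.toLp 2 (b, U y))) :=
      ((WithLp.prod_continuous_toLp 2 F F').tendsto _).comp
        (hla.prodMk_nhds ((U.continuous.tendsto _).comp hlx))
    exact tendsto_iff_norm_sub_tendsto_zero.1 h1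
  -- The distance to the new KKT point converges along the full sequence and tends to zero along a
  -- subsequence, so its limit is zero.
  have hl0 : l = 0 := tendsto_nhds_unique
    ((hl.comp (tendsto_add_atTop_nat 1)).comp hφt) hsub
  subst hl0
  have hUx : Tendsto (fun k => ‖U (x k) - U y‖) atTop (𝓝 0) :=
    squeeze_zero (fun _ => norm_nonneg _)
      (fun k => WithLp.norm_snd_le _ (p k - WithLp.toLp 2 (b, U y))) hl
  rw [tendsto_iff_dist_tendsto_zero]
  have hmax : Tendsto (fun k => (K : ℝ) * max ‖B (x k)‖ ‖U (x k) - U y‖) atTop (𝓝 0) := by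
    simpa using (hBx.norm.max hUx).const_mul (K : ℝ)
  refine squeeze_zero (fun _ => dist_nonneg) (fun k => ?_) hmax
  simpa [Prod.dist_eq, hyB, dist_eq_norm] using hBU.le_mul_dist (x k) y

end InexactADMM

/-! ### Convex minimisation: first-order conditions, existence, multipliers -/

section Convex

variable {E : Type*} [NormedAddCommGroup E] [InnerProductSpace ℝ E]

/-- No differentiability of `h` is needed: compare `x` with `x + t (y - x)`, bound `h` there by
convexity, divide by `t` and let `t → 0`. -/
theorem le_of_isMinOn_add_quadratic {h : E → ℝ} {C : Set E} (hh : ConvexOn ℝ C h) {a x y : E}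
    {r : ℝ} (hx : x ∈ C) (hmin : IsMinOn (fun l => h l + (inner ℝ l a + r * ‖l‖ ^ 2)) C x)
    (hy : y ∈ C) : h x - inner ℝ (a + (2 * r) • x) (y - x) ≤ h y := by
  have key : ∀ t ∈ Set.Ioo (0 : ℝ) 1,
      -(t * (r * ‖y - x‖ ^ 2)) ≤ h y - h x + inner ℝ (a + (2 * r) • x) (y - x) := by
    intro t ht
    have hz : (1 - t) • x + t • y ∈ C :=
      hh.1 hx hy (by linarith [ht.2]) ht.1.le (by ring)
    have h1 := hh.2 hx hy (by linarith [ht.2] : 0 ≤ 1 - t) ht.1.le (by ring)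
    have h2 := isMinOn_iff.1 hmin _ hz
    have h3 : (1 - t) • x + t • y = x + t • (y - x) := by
      rw [smul_sub, sub_smul, one_smul]; abel
    rw [h3] at h1 h2
    have h4 := norm_add_sq_real x (t • (y - x))
    rw [norm_smul, Real.norm_eq_abs, mul_pow, sq_abs, inner_smul_right] at h4
    simp only [h4, inner_add_left, inner_smul_left, smul_eq_mul, RCLike.conj_to_real] at h1 h2 ⊢
    rw [real_inner_comm (y - x) a]
    have h5 : 0 ≤ t * (h y - h x + (inner ℝ (y - x) a + 2 * r * inner ℝ x (y - x)) +
        t * (r * ‖y - x‖ ^ 2)) := by linarith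
    have := nonneg_of_mul_nonneg_right h5 ht.1
    linarith
  have hlim : Tendsto (fun t : ℝ => -(t * (r * ‖y - x‖ ^ 2))) (𝓝[>] 0) (𝓝 0) := by
    have : Continuous fun t : ℝ => -(t * (r * ‖y - x‖ ^ 2)) := by fun_prop
    simpa using (this.tendsto 0).mono_left nhdsWithin_le_nhds
  have := le_of_tendsto hlim (eventually_of_mem (Ioo_mem_nhdsGT one_pos) key)
  linarith

/-- An affine minorant of `h` plus a positive multiple of `‖l‖²` is coercive. -/
theorem exists_isMinOn_add_quadratic [FiniteDimensional ℝ E] {h : E → ℝ} (hh : Continuous h)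
    {C : Set E} (hC : IsClosed C) (hne : C.Nonempty) {b : ℝ} {v : E}
    (hb : ∀ l, b + inner ℝ l v ≤ h l) (a : E) {r : ℝ} (hr : 0 < r) :
    ∃ x ∈ C, IsMinOn (fun l => h l + (inner ℝ l a + r * ‖l‖ ^ 2)) C x := by
  obtain ⟨x₀, hx₀⟩ := hne
  have hlow : Tendsto (fun s : ℝ => b + s * (r * s - ‖v + a‖)) atTop atTop :=
    tendsto_atTop_add_const_left _ _ (tendsto_id.atTop_mul_atTop₀
      (tendsto_atTop_add_const_right _ _ (tendsto_id.const_mul_atTop hr)))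
  have htop : Tendsto (fun l => h l + (inner ℝ l a + r * ‖l‖ ^ 2)) (cocompact E) atTop := by
    refine tendsto_atTop_mono (fun l => ?_) (hlow.comp (tendsto_norm_cocompact_atTop (E := E)))
    have h1 := hb l
    have h2 := abs_le.1 (abs_real_inner_le_norm l (v + a))
    rw [inner_add_right] at h2
    simp only [Function.comp_apply]
    nlinarith [h2.1]
  exact ContinuousOn.exists_isMinOn' (by fun_prop) hC hx₀
    ((htop.eventually_ge_atTop _).filter_mono inf_le_left)

end Convex

/-- The multiplier of the constraint `x ∈ K` in a convex program. -/
theorem exists_dual_of_isMinOn {H : Type*} [NormedAddCommGroup H] [NormedSpace ℝ H] {g : H → ℝ}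
    (hg : ConvexOn ℝ Set.univ g) (hc : Continuous g) {K : Set H} (hK : Convex ℝ K) {x : H}
    (hx : x ∈ K) (hmin : IsMinOn g K x) :
    ∃ φ : H →L[ℝ] ℝ, ∀ y, ∀ z ∈ K, φ (y - z) ≤ g y - g x := by
  -- The strict epigraph of the perturbation function `q ↦ inf_{z ∈ K} g (q + z) - g x`. It is open
  -- and convex, and minimality of `x` keeps the origin out of it, so Hahn–Banach separates the two.
  set A : Set (H × ℝ) := {q | ∃ z ∈ K, g (q.1 + z) - g x < q.2} with hA
  have hopen : IsOpen A := by
    have : A = ⋃ z ∈ K, {q : H × ℝ | g (q.1 + z) - g x < q.2} := by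
      ext q; simp [hA]
    rw [this]
    exact isOpen_biUnion fun z _ => isOpen_lt (by fun_prop) (by fun_prop)
  have hconv : Convex ℝ A := by
    rintro ⟨q, r⟩ ⟨z, hz, hq⟩ ⟨q', r'⟩ ⟨z', hz', hq'⟩ s t hs ht hst
    refine ⟨s • z + t • z', hK hz hz' hs ht hst, ?_⟩
    simp only [Prod.smul_mk, Prod.mk_add_mk, smul_eq_mul] at hq hq' ⊢
    have h1 := hg.2 (Set.mem_univ (q + z)) (Set.mem_univ (q' + z')) hs ht hst
    have h2 : s • q + t • q' + (s • z + t • z') = s • (q + z) + t • (q' + z') := by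
      rw [smul_add, smul_add]; abel
    rw [h2]
    simp only [smul_eq_mul] at h1
    have h3 : s * (g (q + z) - g x) + t * (g (q' + z') - g x) < s * r + t * r' := by
      rcases hs.eq_or_lt with rfl | hs
      · have ht1 : t = 1 := by linarith
        subst ht1; linarith
      · exact add_lt_add_of_lt_of_le (mul_lt_mul_of_pos_left hq hs)
          (mul_le_mul_of_nonneg_left hq'.le ht)
    have h4 : s * g x + t * g x = g x := by rw [← add_mul, hst, one_mul]
    linarith
  have h0 : (0 : H × ℝ) ∉ A := by
    rintro ⟨z, hz, h⟩
    have := isMinOn_iff.1 hmin z hz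
    simp only [Prod.fst_zero, Prod.snd_zero, zero_add] at h
    linarith
  obtain ⟨f, hf⟩ := geometric_hahn_banach_open_point hconv hopen h0
  rw [map_zero] at hf
  set μ : ℝ := -f (0, 1) with hμ
  have hdec : ∀ q r, f (q, r) = f (q, 0) - r * μ := by
    intro q r
    have : (q, r) = (q, (0 : ℝ)) + r • ((0 : H), (1 : ℝ)) := by simp
    rw [this, map_add, map_smul, hμ, smul_eq_mul]; ring
  -- The separating hyperplane is not vertical: `(0, 1)` lies in `A`, with witness `z = x`. Hence
  -- one may divide by `μ`.
  have hμpos : 0 < μ := by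
    have := hf (0, 1) ⟨x, hx, by simp⟩
    linarith
  refine ⟨μ⁻¹ • f.comp (ContinuousLinearMap.inl ℝ H ℝ), fun y z hz => ?_⟩
  simp only [_root_.smul_apply, ContinuousLinearMap.comp_apply,
    ContinuousLinearMap.inl_apply, smul_eq_mul]
  rw [inv_mul_le_iff₀ hμpos]
  refine le_of_forall_pos_le_add fun δ hδ => ?_
  have h1 := hf (y - z, g y - g x + δ / μ)
    ⟨z, hz, by simpa using div_pos hδ hμpos⟩
  rw [hdec] at h1
  have h2 : (g y - g x + δ / μ) * μ = μ * (g y - g x) + δ := by field_simp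
  linarith

/-! ### Incidence maps of the communication graph -/

section Network

variable {ι : Type*} [Fintype ι] {E : Type*} [NormedAddCommGroup E]
  [InnerProductSpace ℝ E] [FiniteDimensional ℝ E] (G : SimpleGraph ι) [DecidableRel G.Adj]

/-- The map taking `x` to the family of all `√(c/2) (x n + σ x m)`, for neighbours `n` and `m`:
a scaled incidence map for `σ = -1`, and its unsigned variant for `σ = 1`. -/
noncomputable def edgeMap (E : Type*) [NormedAddCommGroup E] [InnerProductSpace ℝ E] [FiniteDimensional ℝ E]
    (c σ : ℝ) :
    PiLp 2 (fun _ : ι => E) →L[ℝ] PiLp 2 (fun _ : ι × ι => E) :=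
  LinearMap.toContinuousLinearMap
    { toFun := fun x => WithLp.toLp 2 fun e =>
        if G.Adj e.1 e.2 then √(c / 2) • (x e.1 + σ • x e.2) else 0
      map_add' := fun x y => by
        ext e
        by_cases h : G.Adj e.1 e.2
        · simp only [PiLp.add_apply, h, if_true, smul_add]; abel
        · simp [h]
      map_smul' := fun t x => by
        ext e
        by_cases h : G.Adj e.1 e.2
        · simp only [PiLp.smul_apply, h, if_true, RingHom.id_apply, smul_add,
            smul_comm t]
        · simp [h] }

theorem edgeMap_apply (c σ : ℝ) (x : PiLp 2 fun _ : ι => E) (e : ι × ι) :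
    edgeMap G E c σ x e = if G.Adj e.1 e.2 then √(c / 2) • (x e.1 + σ • x e.2) else 0 :=
  rfl

theorem inner_edgeMap {c σ : ℝ} (hc : 0 ≤ c) (hσ : σ * σ = 1) (x y : PiLp 2 fun _ : ι => E) :
    inner ℝ (edgeMap G E c σ x) (edgeMap G E c σ y) =
      ∑ n, inner ℝ (c • ∑ m ∈ G.neighborFinset n, (x n + σ • x m)) (y n) := by
  have hs : √(c / 2) * √(c / 2) = c / 2 := Real.mul_self_sqrt (by positivity)
  -- The sum runs over ordered pairs, so each edge occurs twice; the factor `√(c / 2)` compensates.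
  -- Splitting each term symmetrically lets the two halves be swapped onto the same node.
  have hL : ∀ n m, inner ℝ (edgeMap G E c σ x (n, m)) (edgeMap G E c σ y (n, m)) =
      (if G.Adj n m then c / 2 * inner ℝ (x n + σ • x m) (y n) else 0) +
      (if G.Adj m n then c / 2 * inner ℝ (x m + σ • x n) (y m) else 0) := by
    intro n m
    rw [edgeMap_apply, edgeMap_apply]
    by_cases h : G.Adj n m
    · simp only [h, h.symm, if_true, inner_smul_left, inner_smul_right, inner_add_left, inner_add_right,
        RCLike.conj_to_real]
      linear_combination (inner ℝ (x n) (y n) + σ * inner ℝ (x m) (y n) +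
        σ * inner ℝ (x n) (y m) + σ * σ * inner ℝ (x m) (y m)) * hs +
        c / 2 * inner ℝ (x m) (y m) * hσ
    · simp [h, mt SimpleGraph.Adj.symm h]
  rw [PiLp.inner_apply, Fintype.sum_prod_type]
  simp only [hL]
  rw [Finset.sum_congr rfl fun n _ => Finset.sum_add_distrib, Finset.sum_add_distrib, Finset.sum_comm (f := fun n m =>
    if G.Adj m n then c / 2 * inner ℝ (x m + σ • x n) (y m) else 0), ← Finset.sum_add_distrib]
  refine Finset.sum_congr rfl fun n _ => ?_
  rw [inner_smul_left, sum_inner, ← Finset.sum_filter, SimpleGraph.neighborFinset_eq_filter,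
    RCLike.conj_to_real, ← Finset.mul_sum]
  ring

theorem edgeMap_neg_one_eq_zero_iff {c : ℝ} (hc : 0 < c) (hG : G.Connected)
    {x : PiLp 2 fun _ : ι => E} : edgeMap G E c (-1) x = 0 ↔ ∀ n m, x n = x m := by
  constructor
  · intro h
    have hadj : ∀ n m, G.Adj n m → x n = x m := by
      intro n m hnm
      have h1 := congrArg (fun z => z (n, m)) h
      simp only [edgeMap_apply, hnm, if_true, PiLp.zero_apply, smul_eq_zero] at h1
      rcases h1 with h1 | h1
      · exact absurd h1 (by positivity)
      · rwa [neg_one_smul, ← sub_eq_add_neg, sub_eq_zero] at h1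
    intro n m
    obtain ⟨w⟩ := hG.preconnected n m
    induction w with
    | nil => rfl
    | cons h _ ih => exact (hadj _ _ h).trans ih
  · intro h
    ext e
    rw [edgeMap_apply, h e.1 e.2]
    simp

/-- `B x = 0` makes `x` constant by connectedness, and `U x = 0` then gives `2 x n = 0` at any node
with a neighbour; every node has one because there are at least two nodes. In finite dimension
injectivity suffices. -/
theorem exists_antilipschitzWith_edgeMap [Nontrivial ι] {c : ℝ} (hc : 0 < c) (hG : G.Connected) :
    ∃ K, AntilipschitzWith K fun x : PiLp 2 (fun _ : ι => E) =>
      (edgeMap G E c (-1) x, edgeMap G E c 1 x) := by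
  obtain ⟨K, -, hK⟩ := LinearMap.exists_antilipschitzWith
    ((edgeMap G E c (-1)).prod (edgeMap G E c 1)).toLinearMap (by
      rw [LinearMap.ker_eq_bot']
      intro x hx
      obtain ⟨h1, h2⟩ := Prod.ext_iff.1 hx
      have h1 := (edgeMap_neg_one_eq_zero_iff G hc hG).1 h1
      ext n
      obtain ⟨m, hnm⟩ := hG.preconnected.exists_adj_of_nontrivial n
      have h3 := congrArg (fun z => z (n, m)) h2
      simp only [ContinuousLinearMap.coe_coe, ContinuousLinearMap.prod_apply, edgeMap_apply, hnm,
        if_true, Prod.snd_zero, PiLp.zero_apply, smul_eq_zero, one_smul, h1 m n] at h3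
      rcases h3 with h3 | h3
      · exact absurd h3 (by positivity)
      · rw [← two_smul ℝ, smul_eq_zero] at h3
        simpa using h3)
  exact ⟨K, hK⟩

/-- The step of the method of multipliers made up of the local updates at all nodes. -/
theorem isStep_of_local {c : ℝ} (hc : 0 ≤ c) {h : ι → E → ℝ} {C : Set E}
    {x e x' e' ν : PiLp 2 fun _ : ι => E} {a a' : PiLp 2 fun _ : ι × ι => E}
    (hν : ∀ z : PiLp 2 fun _ : ι => E,
      ∑ n, inner ℝ (ν n) (z n) = inner ℝ a (edgeMap G E c (-1) z))
    (ha : a' = a + edgeMap G E c (-1) (x' + e')) (hx' : ∀ n, x' n ∈ C)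
    (hloc : ∀ n, ∀ y ∈ C, h n (x' n) - inner ℝ (ν n -
      c • ∑ m ∈ G.neighborFinset n, ((x + e) n + (x + e) m) + (2 * (c * G.degree n)) • x' n)
        (y - x' n) ≤ h n y) :
    IsStep (fun y : PiLp 2 fun _ : ι => E => ∑ n, h n (y n)) {y | ∀ n, y n ∈ C}
      (edgeMap G E c (-1)) (edgeMap G E c 1) x e x' e' a' := by
  refine ⟨hx', fun y hy => ?_⟩
  have hsum := Finset.sum_le_sum fun n (_ : n ∈ Finset.univ) => hloc n (y n) (hy n)
  set z := y - x' with hz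
  have hU := inner_edgeMap G hc (one_mul 1) (x + e) z
  have hBx := inner_edgeMap G hc (show (-1 : ℝ) * (-1) = 1 by norm_num) x' z
  have hUx := inner_edgeMap G hc (one_mul 1) x' z
  -- The identity `Bᵀ B + Uᵀ U = 2c · degree`, which turns the quadratic term of the local updates
  -- into an augmented Lagrangian part and a proximal part.
  have hdeg : ∑ n, inner ℝ ((2 * (c * G.degree n)) • x' n) (z n) =
      inner ℝ (edgeMap G E c (-1) x') (edgeMap G E c (-1) z) +
      inner ℝ (edgeMap G E c 1 x') (edgeMap G E c 1 z) := by
    rw [hBx, hUx, ← Finset.sum_add_distrib]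
    refine Finset.sum_congr rfl fun n _ => ?_
    rw [← inner_add_left, ← smul_add, ← Finset.sum_add_distrib]
    congr 1
    have : ∀ m, x' n + (-1 : ℝ) • x' m + (x' n + (1 : ℝ) • x' m) = (2 : ℝ) • x' n := by
      intro m; rw [neg_one_smul, one_smul, two_smul]; abel
    simp only [this, Finset.sum_const, SimpleGraph.card_neighborFinset_eq_degree]
    rw [← Nat.cast_smul_eq_nsmul ℝ, smul_smul, smul_smul]
    congr 1; ring
  have hsplit : ∀ n, inner ℝ (ν n - c • ∑ m ∈ G.neighborFinset n, ((x + e) n + (x + e) m) +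
      (2 * (c * G.degree n)) • x' n) (y n - x' n) =
      inner ℝ (ν n) (z n) -
      inner ℝ (c • ∑ m ∈ G.neighborFinset n, ((x + e) n + (1 : ℝ) • (x + e) m)) (z n) +
      inner ℝ ((2 * (c * G.degree n)) • x' n) (z n) := by
    intro n
    simp only [one_smul, hz, PiLp.sub_apply, inner_add_left, inner_sub_left]
  simp only [hsplit] at hsum
  rw [Finset.sum_sub_distrib, Finset.sum_add_distrib, Finset.sum_sub_distrib, hν, ← hU, hdeg] at hsum
  have ha' : a = a' - edgeMap G E c (-1) x' - edgeMap G E c (-1) e' := by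
    rw [ha, map_add]; abel
  rw [ha'] at hsum
  simp only [map_add, map_sub (edgeMap G E c 1) _ e, map_sub (edgeMap G E c 1) x' x,
    inner_sub_left, inner_add_left] at hsum ⊢
  linarith

/-- Existence of multipliers for the consensus constraints of a convex program. -/
theorem exists_isKKT_of_isMinOn {c : ℝ} (hc : 0 < c) (hG : G.Connected) {h : ι → E → ℝ}
    (hh : ∀ n, ConvexOn ℝ Set.univ (h n)) (hcont : ∀ n, Continuous (h n)) {C : Set E}
    (hC : Convex ℝ C) {x : E} (hx : x ∈ C) (hmin : IsMinOn (fun l => ∑ n, h n l) C x) :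
    ∃ b, IsKKT (fun y : PiLp 2 fun _ : ι => E => ∑ n, h n (y n)) {y | ∀ n, y n ∈ C}
      (edgeMap G E c (-1)) (WithLp.toLp 2 fun _ => x) b := by
  obtain ⟨i⟩ := hG.nonempty
  let diag : E →ₗ[ℝ] PiLp 2 (fun _ : ι => E) :=
    { toFun := fun l => WithLp.toLp 2 fun _ => l
      map_add' := fun _ _ => rfl
      map_smul' := fun _ _ => rfl }
  let ev : PiLp 2 (fun _ : ι => E) →ₗ[ℝ] E :=
    { toFun := fun y => y i
      map_add' := fun _ _ => rfl
      map_smul' := fun _ _ => rfl }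
  have hgc : ConvexOn ℝ Set.univ fun y : PiLp 2 (fun _ : ι => E) => ∑ n, h n (y n) := by
    refine ⟨convex_univ, fun y _ z _ s t hs ht hst => ?_⟩
    rw [Finset.smul_sum, Finset.smul_sum, ← Finset.sum_add_distrib]
    exact Finset.sum_le_sum fun n _ =>
      (hh n).2 (Set.mem_univ (y n)) (Set.mem_univ (z n)) hs ht hst
  have hmin' : IsMinOn (fun y : PiLp 2 (fun _ : ι => E) => ∑ n, h n (y n)) (diag '' C)
      (diag x) := by
    rw [isMinOn_iff]
    rintro _ ⟨l, hl, rfl⟩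
    exact isMinOn_iff.1 hmin l hl
  obtain ⟨φ, hφ⟩ := exists_dual_of_isMinOn hgc
    (continuous_finsetSum _ fun n _ => (hcont n).comp (PiLp.continuous_apply 2 _ n))
    (hC.linear_image diag) ⟨x, hx, rfl⟩ hmin'
  -- Subtracting the value at the diagonal vector through the entry at `i` makes the functional
  -- vanish on the kernel of `B`, so that it factors through `B`. The correction is harmless on `S`:
  -- there `y i ∈ C`, and `φ` is maximal over the diagonal copy of `C` in the direction controlled
  -- by `h3`.
  let ψ : PiLp 2 (fun _ : ι => E) →ₗ[ℝ] ℝ := φ.toLinearMap ∘ₗ (LinearMap.id - diag ∘ₗ ev)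
  have hψ : ∀ y, ψ y = φ y - φ (diag (y i)) := fun y => map_sub φ y (diag (y i))
  obtain ⟨θ, hθ⟩ : ψ ∈ LinearMap.range (edgeMap G E c (-1)).toLinearMap.dualMap := by
    rw [LinearMap.range_dualMap_eq_dualAnnihilator_ker, Submodule.mem_dualAnnihilator]
    intro y hy
    have hy := (edgeMap_neg_one_eq_zero_iff G hc hG).1 hy
    have : y = diag (y i) := by ext n : 1; exact hy n i
    rw [hψ, ← this, sub_self]
  refine ⟨-(InnerProductSpace.toDual ℝ _).symm (LinearMap.toContinuousLinearMap θ),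
    fun _ => hx, (edgeMap_neg_one_eq_zero_iff G hc hG).2 fun _ _ => rfl, fun y hy => ?_⟩
  rw [inner_neg_left, InnerProductSpace.toDual_symm_apply]
  have h1 : θ (edgeMap G E c (-1) y) = φ y - φ (diag (y i)) := by
    rw [← hψ, ← hθ]; rfl
  have h2 := hφ y (diag x) ⟨x, hx, rfl⟩
  have h3 := hφ (diag x) (diag (y i)) ⟨y i, hy i, rfl⟩
  rw [map_sub] at h2 h3
  rw [LinearMap.coe_toContinuousLinearMap', h1]
  have h4 : ∑ n, h n (diag x n) = ∑ n, h n x := rfl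
  rw [h4] at h2 h3
  change ∑ n, h n x - _ ≤ _
  linarith

end Network

/-! ### Passage between extended real and real objectives -/

theorem ereal_sum_ne_bot {ι : Type*} {s : Finset ι} {F : ι → EReal} (h : ∀ i ∈ s, F i ≠ ⊥) :
    ∑ i ∈ s, F i ≠ ⊥ :=
  Finset.sum_induction F (· ≠ ⊥) (fun _ _ ha hb => by simp [EReal.add_eq_bot_iff, ha, hb])
    EReal.zero_ne_bot h

theorem ereal_sum_eq_top {ι : Type*} {s : Finset ι} {F : ι → EReal} (h : ∀ i ∈ s, F i ≠ ⊥)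
    {i : ι} (hi : i ∈ s) (hF : F i = ⊤) : ∑ i ∈ s, F i = ⊤ := by
  classical
  rw [← Finset.add_sum_erase s F hi, hF]
  exact EReal.top_add_of_ne_bot (ereal_sum_ne_bot fun j hj => h j (Finset.mem_of_mem_erase hj))

theorem ereal_coe_sum {ι : Type*} (s : Finset ι) (F : ι → ℝ) :
    ((∑ i ∈ s, F i : ℝ) : EReal) = ∑ i ∈ s, (F i : EReal) :=
  map_sum (⟨⟨Real.toEReal, EReal.coe_zero⟩, EReal.coe_add⟩ : ℝ →+ EReal) F s

theorem isMinOn_univ_iff_of_eq_top {α : Type*} {C : Set α} {F : α → EReal} {h : α → ℝ}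
    (hF : ∀ x ∈ C, F x = h x) (hF' : ∀ x ∉ C, F x = ⊤) (hne : C.Nonempty) {x : α} :
    IsMinOn F Set.univ x ↔ x ∈ C ∧ IsMinOn h C x := by
  simp only [isMinOn_iff, Set.mem_univ, true_imp_iff]
  constructor
  · intro H
    have hx : x ∈ C := by
      by_contra hx
      obtain ⟨y, hy⟩ := hne
      have := H y
      rw [hF' x hx, hF y hy, top_le_iff] at this
      exact EReal.coe_ne_top _ this
    refine ⟨hx, fun y hy => ?_⟩
    have := H y
    rwa [hF x hx, hF y hy, EReal.coe_le_coe_iff] at this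
  · rintro ⟨hx, H⟩ y
    by_cases hy : y ∈ C
    · rw [hF x hx, hF y hy, EReal.coe_le_coe_iff]
      exact H y hy
    · rw [hF' y hy]
      exact le_top

theorem Vehicle.isBounded_feasible {T : ℕ} (v : Vehicle) (Δ : ℝ) :
    Bornology.IsBounded (v.feasible (T := T) Δ) := by
  refine (Metric.isBounded_closedBall (x := 0) (r := |v.inverterCapacity|)).subset fun x hx => ?_
  have h := hx.2.2.2.2.2
  rw [mem_closedBall_zero_iff, Prod.norm_def, max_le_iff,
    pi_norm_le_iff_of_nonneg (abs_nonneg _), pi_norm_le_iff_of_nonneg (abs_nonneg _)]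
  exact ⟨fun t => sq_le_sq.1 (by nlinarith [h t, sq_nonneg (x.2 t)]),
    fun t => sq_le_sq.1 (by nlinarith [h t, sq_nonneg (x.1 t)])⟩

/-! ### The functions `φ_n` and the local costs -/

namespace Model

variable {N T : ℕ} (M : Model N T)

/-- The non-negative orthant, which is the effective domain of the functions `φ_n`. -/
def orthant : Set M.Dual := {l | ∀ i, 0 ≤ l i}

theorem zero_mem_orthant : (0 : M.Dual) ∈ M.orthant := fun _ => le_rfl

theorem convex_orthant : Convex ℝ M.orthant := by
  intro x hx y hy s t hs ht _ i
  exact add_nonneg (mul_nonneg hs (hx i)) (mul_nonneg ht (hy i))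

theorem isClosed_orthant : IsClosed M.orthant := by
  simp only [orthant, Set.ofPred_forall]
  exact isClosed_iInter fun i => isClosed_le continuous_const (PiLp.continuous_apply 2 _ i)

/-- The affine function `-Ω_n(p) - lᵀ (Γ_n p + Ξ_n q)` of `l`. -/
noncomputable def payoff (n : Fin N) (x : (Fin T → ℝ) × (Fin T → ℝ)) (l : M.Dual) : ℝ :=
  -(M.vehicle n).cost M.Δ M.η x.1 - inner ℝ l (M.Psi n (x.1, x.2, 0))

/-- The restriction of `φ_n` to the non-negative orthant. -/
noncomputable def value (n : Fin N) (l : M.Dual) : ℝ :=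
  ⨆ x : (M.vehicle n).feasible (T := T) M.Δ, M.payoff n x l

theorem Psi_eq (n : Fin N) (p q : Fin T → ℝ) (s : M.DualIdx → ℝ) :
    M.Psi n (p, q, s) = M.Psi n (p, q, 0) + WithLp.toLp 2 s := by
  simp [Psi]

/-- The inverter capacity bounds the feasible profiles. The bound holds for every `l`, not only in
the orthant, so `value` is finite everywhere and its continuity follows from convexity. -/
theorem bddAbove_payoff (n : Fin N) (l : M.Dual) :
    BddAbove (Set.range fun x : (M.vehicle n).feasible (T := T) M.Δ => M.payoff n x l) := by
  have hc : Continuous fun x => M.payoff n x l := by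
    unfold payoff Vehicle.cost Psi dotProduct Matrix.mulVec dotProduct
    fun_prop
  refine (((M.vehicle n).isBounded_feasible M.Δ).isCompact_closure.bddAbove_image
    hc.continuousOn).mono ?_
  rintro _ ⟨x, rfl⟩
  exact ⟨x, subset_closure x.2, rfl⟩

theorem payoff_le_value (n : Fin N) {x : (Fin T → ℝ) × (Fin T → ℝ)}
    (hx : x ∈ (M.vehicle n).feasible M.Δ) (l : M.Dual) : M.payoff n x l ≤ M.value n l :=
  le_ciSup (M.bddAbove_payoff n l) ⟨x, hx⟩

/-- The payoff is affine in `l` whatever the sign of the regularisation parameter, and a supremum of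
affine functions is convex. -/
theorem convexOn_value (n : Fin N) (hne : ((M.vehicle n).feasible (T := T) M.Δ).Nonempty) :
    ConvexOn ℝ Set.univ (M.value n) := by
  have := hne.to_subtype
  refine ⟨convex_univ, fun l _ m _ s t hs ht hst => ciSup_le fun x => ?_⟩
  have h1 := mul_le_mul_of_nonneg_left (M.payoff_le_value n x.2 l) hs
  have h2 := mul_le_mul_of_nonneg_left (M.payoff_le_value n x.2 m) ht
  have h3 : M.payoff n x (s • l + t • m) = s * M.payoff n x l + t * M.payoff n x m := by
    simp only [payoff, inner_add_left, inner_smul_left, RCLike.conj_to_real]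
    linear_combination (M.vehicle n).cost M.Δ M.η x.1.1 * hst
  rw [h3]
  exact add_le_add h1 h2

theorem neg_f_sub_inner {n : Fin N} {u : M.Decision} (hu : u ∈ M.localSet n) (l : M.Dual) :
    -M.f n u - ((inner ℝ l (M.Psi n u) : ℝ) : EReal) =
      ((M.payoff n (u.1, u.2.1) l - inner ℝ l (WithLp.toLp 2 u.2.2 : M.Dual) : ℝ) : EReal) := by
  obtain ⟨p, q, s⟩ := u
  rw [f, if_pos hu, ← EReal.coe_neg, ← EReal.coe_sub, Psi_eq, inner_add_right, payoff]
  congr 1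
  ring

theorem phi_of_mem {n : Fin N} (hne : ((M.vehicle n).feasible (T := T) M.Δ).Nonempty)
    {l : M.Dual} (hl : l ∈ M.orthant) : M.phi n l = (M.value n l : EReal) := by
  have := hne.to_subtype
  apply le_antisymm
  · refine iSup_le fun u => ?_
    by_cases hu : u ∈ M.localSet n
    · rw [M.neg_f_sub_inner hu, EReal.coe_le_coe_iff]
      have h1 := M.payoff_le_value n hu.1 l
      have h2 : 0 ≤ inner ℝ l (WithLp.toLp 2 u.2.2 : M.Dual) := by
        rw [PiLp.inner_apply]
        exact Finset.sum_nonneg fun i _ => mul_nonneg (hu.2 i) (hl i)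
      linarith
    · simp [f, hu]
  · by_contra! h
    obtain ⟨r, h1, h2⟩ := EReal.lt_iff_exists_real_btwn.1 h
    obtain ⟨x, hx⟩ := exists_lt_of_lt_ciSup (EReal.coe_lt_coe_iff.1 h2)
    have hu : ((x.1.1, x.1.2, 0) : M.Decision) ∈ M.localSet n := ⟨x.2, le_rfl⟩
    have h3 := le_iSup (fun u : M.Decision =>
      -M.f n u - ((inner ℝ l (M.Psi n u) : ℝ) : EReal)) (x.1.1, x.1.2, 0)
    simp only [M.neg_f_sub_inner hu, WithLp.toLp_zero, inner_zero_right, sub_zero] at h3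
    exact absurd (EReal.coe_lt_coe_iff.2 hx) (not_lt.2 (h3.trans h1.le))

theorem phi_of_notMem {n : Fin N} (hne : ((M.vehicle n).feasible (T := T) M.Δ).Nonempty)
    {l : M.Dual} (hl : l ∉ M.orthant) : M.phi n l = ⊤ := by
  classical
  obtain ⟨i, hi⟩ : ∃ i, l i < 0 := by
    by_contra! h
    exact hl h
  obtain ⟨x, hx⟩ := hne
  rw [EReal.eq_top_iff_forall_lt]
  intro y
  -- A slack concentrated at the negative coordinate `i`, of a size that lifts the supremand to at
  -- least `y + 1`.
  set t := |y + 1 - M.payoff n x l| / -l i with ht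
  have ht0 : 0 ≤ t := div_nonneg (abs_nonneg _) (by linarith)
  have hu : ((x.1, x.2, Pi.single i t) : M.Decision) ∈ M.localSet n :=
    ⟨hx, Pi.single_nonneg.2 ht0⟩
  have h3 := le_iSup (fun u : M.Decision =>
    -M.f n u - ((inner ℝ l (M.Psi n u) : ℝ) : EReal)) (x.1, x.2, Pi.single i t)
  simp only [M.neg_f_sub_inner hu] at h3
  refine lt_of_lt_of_le (EReal.coe_lt_coe_iff.2 ?_) h3
  have h4 : inner ℝ l (WithLp.toLp 2 (Pi.single i t) : M.Dual) = t * l i := by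
    simp [PiLp.inner_apply]
  have h5 : t * l i = -|y + 1 - M.payoff n x l| := by
    rw [ht, div_neg, neg_mul, div_mul_cancel₀ _ hi.ne]
  rw [h4, h5]
  linarith [le_abs_self (y + 1 - M.payoff n x l)]

/-- The restriction of the local cost to the non-negative orthant. -/
noncomputable def realCost (n : Fin N) (l : M.Dual) : ℝ :=
  M.value n l + 1 / (N : ℝ) * inner ℝ l M.w

theorem convexOn_realCost (n : Fin N) (hne : ((M.vehicle n).feasible (T := T) M.Δ).Nonempty) :
    ConvexOn ℝ Set.univ (M.realCost n) := by
  refine (M.convexOn_value n hne).add ⟨convex_univ, fun l _ m _ s t _ _ _ => le_of_eq ?_⟩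
  simp only [inner_add_left, inner_smul_left, RCLike.conj_to_real, smul_eq_mul]
  ring

theorem continuous_realCost (n : Fin N)
    (hne : ((M.vehicle n).feasible (T := T) M.Δ).Nonempty) : Continuous (M.realCost n) := by
  have := (M.convexOn_realCost n hne).continuousOn_interior
  rwa [interior_univ, continuousOn_univ] at this

/-- Any single feasible profile yields an affine minorant; it provides the coercivity of the local
subproblems. -/
theorem exists_le_realCost (n : Fin N)
    (hne : ((M.vehicle n).feasible (T := T) M.Δ).Nonempty) :
    ∃ (b : ℝ) (v : M.Dual), ∀ l, b + inner ℝ l v ≤ M.realCost n l := by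
  obtain ⟨x, hx⟩ := hne
  refine ⟨-(M.vehicle n).cost M.Δ M.η x.1, (1 / (N : ℝ)) • M.w - M.Psi n (x.1, x.2, 0),
    fun l => ?_⟩
  have := M.payoff_le_value n hx l
  rw [payoff] at this
  rw [realCost, inner_sub_right, inner_smul_right]
  linarith

theorem localCost_of_mem {n : Fin N} (hne : ((M.vehicle n).feasible (T := T) M.Δ).Nonempty)
    {l : M.Dual} (hl : l ∈ M.orthant) : M.localCost n l = (M.realCost n l : EReal) := by
  rw [localCost, M.phi_of_mem hne hl, ← EReal.coe_add, realCost]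

theorem localCost_of_notMem {n : Fin N} (hne : ((M.vehicle n).feasible (T := T) M.Δ).Nonempty)
    {l : M.Dual} (hl : l ∉ M.orthant) : M.localCost n l = ⊤ := by
  rw [localCost, M.phi_of_notMem hne hl, EReal.top_add_coe]

theorem objP3_of_mem (hne : ∀ n, ((M.vehicle n).feasible (T := T) M.Δ).Nonempty)
    {l : Fin N → M.Dual} (hl : ∀ n, l n ∈ M.orthant) :
    M.objP3 l = ((∑ n, M.realCost n (l n) : ℝ) : EReal) := by
  rw [ereal_coe_sum, objP3]
  exact Finset.sum_congr rfl fun n _ => M.localCost_of_mem (hne n) (hl n)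

theorem objP3_of_notMem (hne : ∀ n, ((M.vehicle n).feasible (T := T) M.Δ).Nonempty)
    {l : Fin N → M.Dual} (hl : ¬∀ n, l n ∈ M.orthant) : M.objP3 l = ⊤ := by
  push Not at hl
  obtain ⟨n, hn⟩ := hl
  refine ereal_sum_eq_top (fun m _ => ?_) (Finset.mem_univ n) (M.localCost_of_notMem (hne n) hn)
  by_cases hm : l m ∈ M.orthant
  · rw [M.localCost_of_mem (hne m) hm]; exact EReal.coe_ne_bot _
  · rw [M.localCost_of_notMem (hne m) hm]; exact top_ne_bot

theorem nonempty_feasible_of_isOptimalP2 {u : Fin N → M.Decision} (hu : M.IsOptimalP2 u)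
    (n : Fin N) : ((M.vehicle n).feasible (T := T) M.Δ).Nonempty := by
  by_contra h
  have hn : u n ∉ M.localSet n := fun h' => h ⟨_, h'.1⟩
  refine hu.2.1.ne (ereal_sum_eq_top (fun m _ => ?_) (Finset.mem_univ n) (by simp [f, hn]))
  by_cases hm : u m ∈ M.localSet m <;> simp [f, hm]

end Model

/-! ### The consensus problem `𝒫3` and the well-posedness of the algorithm -/

namespace Model

variable {N T : ℕ} (M : Model N T) (G : SimpleGraph (Fin N))

theorem FeasibleP3.eq {M : Model N T} {G : SimpleGraph (Fin N)} (hG : G.Connected)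
    {l : Fin N → M.Dual} {β : Fin N → Fin N → M.Dual} (h : M.FeasibleP3 G l β) (n m : Fin N) :
    l n = l m := by
  obtain ⟨w⟩ := hG.preconnected n m
  induction w with
  | nil => rfl
  | cons h' _ ih => exact ((h _ _ h').1.trans (h _ _ h').2.symm).trans ih

theorem feasibleP3_const (x : M.Dual) : M.FeasibleP3 G (fun _ => x) fun _ _ => x :=
  fun _ _ _ => ⟨rfl, rfl⟩

theorem exists_isMinOn_of_isOptimalP3
    (hne : ∀ n, ((M.vehicle n).feasible (T := T) M.Δ).Nonempty) (hG : G.Connected)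
    {l : Fin N → M.Dual} (hl : M.IsOptimalP3 G l) :
    ∃ x ∈ M.orthant, IsMinOn (fun y => ∑ n, M.realCost n y) M.orthant x := by
  obtain ⟨i⟩ := hG.nonempty
  obtain ⟨⟨β, hβ⟩, htop, hmin⟩ := hl
  have hconst : l = fun _ => l i := funext fun n => hβ.eq hG n i
  rw [hconst] at htop hmin
  have hi : ∀ _ : Fin N, l i ∈ M.orthant := by
    by_contra h
    exact htop.ne (M.objP3_of_notMem hne h)
  refine ⟨l i, hi i, isMinOn_iff.2 fun y hy => ?_⟩
  have := hmin _ _ (M.feasibleP3_const G y)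
  rwa [M.objP3_of_mem hne hi, M.objP3_of_mem hne fun _ => hy, EReal.coe_le_coe_iff] at this

variable [DecidableRel G.Adj]

theorem isOptimalP3_of_isKKT (hne : ∀ n, ((M.vehicle n).feasible (T := T) M.Δ).Nonempty)
    (hG : G.Connected) {c : ℝ} (hc : 0 < c) {y : PiLp 2 fun _ : Fin N => M.Dual}
    {b : PiLp 2 fun _ : Fin N × Fin N => M.Dual}
    (h : IsKKT (fun y : PiLp 2 fun _ : Fin N => M.Dual => ∑ n, M.realCost n (y n))
      {y | ∀ n, y n ∈ M.orthant} (edgeMap G M.Dual c (-1)) y b) :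
    M.IsOptimalP3 G y := by
  have hy := (edgeMap_neg_one_eq_zero_iff G hc hG).1 h.2.1
  refine ⟨⟨fun n _ => y n, fun n m _ => ⟨rfl, hy m n⟩⟩, ?_, fun l β hl => ?_⟩
  · rw [M.objP3_of_mem hne h.1]
    exact EReal.coe_lt_top _
  · by_cases hmem : ∀ n, l n ∈ M.orthant
    · rw [M.objP3_of_mem hne h.1, M.objP3_of_mem hne hmem, EReal.coe_le_coe_iff]
      have h1 := h.2.2 (WithLp.toLp 2 l) hmem
      rw [(edgeMap_neg_one_eq_zero_iff G hc hG).2 (fun n m => hl.eq hG n m), inner_zero_right,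
        sub_zero] at h1
      exact h1
    · rw [M.objP3_of_notMem hne hmem]
      exact le_top

theorem isMinOn_updateObjective_iff
    (hne : ∀ n, ((M.vehicle n).feasible (T := T) M.Δ).Nonempty) (c : ℝ) (ν : M.Dual)
    (hat : Fin N → M.Dual) (n : Fin N) (x : M.Dual) :
    IsMinOn (M.updateObjective G c ν hat n) Set.univ x ↔ x ∈ M.orthant ∧
      IsMinOn (fun l => M.realCost n l +
        (inner ℝ l (ν - c • ∑ m ∈ G.neighborFinset n, (hat n + hat m)) +
          c * (G.degree n : ℝ) * ‖l‖ ^ 2)) M.orthant x := by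
  refine isMinOn_univ_iff_of_eq_top (fun l hl => ?_) (fun l hl => ?_) ⟨0, M.zero_mem_orthant⟩
  · rw [updateObjective, M.localCost_of_mem (hne n) hl, ← EReal.coe_add]
  · rw [updateObjective, M.localCost_of_notMem (hne n) hl, EReal.top_add_coe]

theorem exists_isMinOn_updateObjective
    (hne : ∀ n, ((M.vehicle n).feasible (T := T) M.Δ).Nonempty) (hN : 2 ≤ N)
    (hG : G.Connected) {c : ℝ} (hc : 0 < c) (ν : M.Dual) (hat : Fin N → M.Dual) (n : Fin N) :
    ∃ x, IsMinOn (M.updateObjective G c ν hat n) Set.univ x := by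
  have := Fin.nontrivial_iff_two_le.2 hN
  have hdeg : 0 < G.degree n := hG.preconnected.degree_pos_of_nontrivial n
  obtain ⟨b, v, hb⟩ := M.exists_le_realCost n (hne n)
  obtain ⟨x, hx, hmin⟩ := exists_isMinOn_add_quadratic (M.continuous_realCost n (hne n))
    M.isClosed_orthant ⟨0, M.zero_mem_orthant⟩ hb
    (ν - c • ∑ m ∈ G.neighborFinset n, (hat n + hat m))
    (show 0 < c * (G.degree n : ℝ) by positivity)
  exact ⟨x, (M.isMinOn_updateObjective_iff G hne c ν hat n x).2 ⟨hx, hmin⟩⟩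

theorem exists_isCCADMM {c : ℝ} (γ ε : ℝ)
    (h : ∀ (ν : M.Dual) (hat : Fin N → M.Dual) (n : Fin N),
      ∃ x, IsMinOn (M.updateObjective G c ν hat n) Set.univ x) :
    ∃ lam nu hat : ℕ → Fin N → M.Dual, M.IsCCADMM G c γ ε lam nu hat := by
  choose upd hupd using h
  let newHat (k : ℕ) (nu hat : Fin N → M.Dual) (n : Fin N) : M.Dual :=
    if 0 ≤ M.censor γ ε (k + 1) (hat n - upd (nu n) hat n) then upd (nu n) hat n else hat n
  let next (k : ℕ) (s : (Fin N → M.Dual) × (Fin N → M.Dual) × (Fin N → M.Dual)) :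
      (Fin N → M.Dual) × (Fin N → M.Dual) × (Fin N → M.Dual) :=
    (fun n => upd (s.2.1 n) s.2.2 n,
      fun n => s.2.1 n + c • ∑ m ∈ G.neighborFinset n,
        (newHat k s.2.1 s.2.2 n - newHat k s.2.1 s.2.2 m),
      newHat k s.2.1 s.2.2)
  let state (k : ℕ) : (Fin N → M.Dual) × (Fin N → M.Dual) × (Fin N → M.Dual) :=
    Nat.rec (0, 0, 0) next k
  exact ⟨fun k => (state k).1, fun k => (state k).2.1, fun k => (state k).2.2,
    { lam_zero := fun _ => rfl
      nu_zero := fun _ => rfl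
      hat_zero := fun _ => rfl
      lam_succ := fun _ _ => hupd _ _ _
      hat_succ := fun _ _ => rfl
      nu_succ := fun _ _ => rfl }⟩

/-! ### Convergence of the censored iteration -/

namespace IsCCADMM

variable {M G} {c γ ε : ℝ} {lam nu hat : ℕ → Fin N → M.Dual}

/-- After a broadcast the two vectors agree; without one, the censoring test has just certified that
they are closer than the threshold. Initially both are zero. -/
theorem norm_hat_sub_lam_le (h : M.IsCCADMM G c γ ε lam nu hat) (hγ : 0 ≤ γ) (hε : 0 ≤ ε)
    (k : ℕ) (n : Fin N) : ‖hat k n - lam k n‖ ≤ γ * ε ^ k := by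
  have hpos : 0 ≤ γ * ε ^ k := by positivity
  cases k with
  | zero => simpa [h.hat_zero, h.lam_zero] using hγ
  | succ k =>
    rw [h.hat_succ]
    split_ifs with hcen
    · simpa using hpos
    · rw [censor, not_le] at hcen
      linarith

theorem summable_norm_hat_sub_lam (h : M.IsCCADMM G c γ ε lam nu hat) (hγ : 0 ≤ γ) (hε₀ : 0 ≤ ε)
    (hε₁ : ε < 1) :
    Summable fun k => ‖(WithLp.toLp 2 (hat k - lam k) : PiLp 2 fun _ : Fin N => M.Dual)‖ := by
  refine Summable.of_nonneg_of_le (fun _ => norm_nonneg _) (fun k => ?_)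
    ((summable_geometric_of_lt_one hε₀ hε₁).mul_left (√N * γ))
  rw [PiLp.norm_eq_of_L2, mul_assoc]
  refine Real.sqrt_le_iff.2 ⟨by positivity, ?_⟩
  rw [mul_pow, Real.sq_sqrt (Nat.cast_nonneg N)]
  have := Finset.sum_le_card_nsmul Finset.univ (fun n => ‖hat k n - lam k n‖ ^ 2)
    ((γ * ε ^ k) ^ 2) fun n _ =>
      pow_le_pow_left₀ (norm_nonneg _) (h.norm_hat_sub_lam_le hγ hε₀ k n) 2
  simpa using this

/-- The dual variables of the edges whose divergences are the variables `nu`. -/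
theorem sum_inner_nu (h : M.IsCCADMM G c γ ε lam nu hat) (hc : 0 ≤ c) (k : ℕ)
    (z : PiLp 2 fun _ : Fin N => M.Dual) :
    ∑ n, inner ℝ (nu k n) (z n) =
      inner ℝ (∑ j ∈ Finset.range k, edgeMap G M.Dual c (-1) (WithLp.toLp 2 (hat (j + 1))))
        (edgeMap G M.Dual c (-1) z) := by
  -- The base case uses `nu 0 = 0`, which puts the initial `nu` in the range of `Bᵀ`; each update
  -- stays in that range.
  induction k with
  | zero => simp [h.nu_zero]
  | succ k ih =>
    rw [Finset.sum_range_succ, inner_add_left, ← ih, inner_edgeMap G hc (by norm_num),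
      ← Finset.sum_add_distrib]
    refine Finset.sum_congr rfl fun n _ => ?_
    rw [h.nu_succ, inner_add_left]
    simp only [neg_one_smul, ← sub_eq_add_neg]

theorem exists_tendsto (h : M.IsCCADMM G c γ ε lam nu hat)
    (hne : ∀ n, ((M.vehicle n).feasible (T := T) M.Δ).Nonempty) (hN : 2 ≤ N)
    (hG : G.Connected) (hP3 : ∃ l, M.IsOptimalP3 G l) (hc : 0 < c) (hγ : 0 ≤ γ) (hε₀ : 0 ≤ ε)
    (hε₁ : ε < 1) :
    ∃ l : Fin N → M.Dual, M.IsOptimalP3 G l ∧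
      ∀ n, Tendsto (fun k => lam k n) atTop (𝓝 (l n)) := by
  have := Fin.nontrivial_iff_two_le.2 hN
  obtain ⟨l, hl⟩ := hP3
  obtain ⟨x, hx, hmin⟩ := M.exists_isMinOn_of_isOptimalP3 G hne hG hl
  obtain ⟨b, hb⟩ := exists_isKKT_of_isMinOn G hc hG (fun n => M.convexOn_realCost n (hne n))
    (fun n => M.continuous_realCost n (hne n)) M.convex_orthant hx hmin
  obtain ⟨K, hK⟩ := exists_antilipschitzWith_edgeMap (E := M.Dual) G hc hG
  have hhat : ∀ k, (WithLp.toLp 2 (lam k) : PiLp 2 fun _ : Fin N => M.Dual) +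
      WithLp.toLp 2 (hat k - lam k) = WithLp.toLp 2 (hat k) := by
    intro k
    rw [← WithLp.toLp_add, add_sub_cancel]
  have hclosed : IsClosed {y : PiLp 2 fun _ : Fin N => M.Dual | ∀ n, y n ∈ M.orthant} := by
    simp only [Set.ofPred_forall]
    exact isClosed_iInter fun n => M.isClosed_orthant.preimage (PiLp.continuous_apply 2 _ n)
  obtain ⟨y, b, hy, hlim⟩ := exists_tendsto_of_isStep
    (continuous_finsetSum _ fun n _ =>
      (M.continuous_realCost n (hne n)).comp (PiLp.continuous_apply 2 _ n))
    hclosed hK (h.summable_norm_hat_sub_lam hγ hε₀ hε₁)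
    (x := fun k => WithLp.toLp 2 (lam k))
    -- The edge multipliers are not computed by the algorithm; they accumulate `B` applied to the
    -- broadcasts, and `B (x + e)` is `B` of the broadcast vector.
    (a := fun k => ∑ j ∈ Finset.range k,
      edgeMap G M.Dual c (-1) (WithLp.toLp 2 (hat (j + 1))))
    (fun k => by rw [Finset.sum_range_succ, hhat])
    (fun k => by
      have hstep := fun n => (M.isMinOn_updateObjective_iff G hne c _ _ n _).1 (h.lam_succ k n)
      refine isStep_of_local G hc.le (ν := WithLp.toLp 2 (nu k)) (h.sum_inner_nu hc.le k)
        (by rw [Finset.sum_range_succ, hhat]) (fun n => (hstep n).1) fun n y hy => ?_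
      rw [hhat]
      exact le_of_isMinOn_add_quadratic
        ((M.convexOn_realCost n (hne n)).subset (Set.subset_univ _) M.convex_orthant)
        (hstep n).1 (hstep n).2 hy)
    ⟨_, b, hb⟩
  exact ⟨y, M.isOptimalP3_of_isKKT G hne hG hc hy,
    fun n => ((PiLp.continuous_apply 2 _ n).tendsto y).comp hlim⟩

end IsCCADMM

end Model

end EVCharging

theorem mainTheorem1 {N T : ℕ} (hN : 2 ≤ N) (M : EVCharging.Model N T)
    (G : SimpleGraph (Fin N)) [DecidableRel G.Adj] (hG : G.Connected)
    (hP2 : ∃ u, M.IsOptimalP2 u) (hP3 : ∃ l, M.IsOptimalP3 G l)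
    (c γ ε : ℝ) (hc : 0 < c) (hγ : 0 < γ) (hε₀ : 0 < ε) (hε₁ : ε < 1) :
    (∃ lam nu hat : ℕ → Fin N → M.Dual, M.IsCCADMM G c γ ε lam nu hat) ∧
    ∀ lam nu hat : ℕ → Fin N → M.Dual, M.IsCCADMM G c γ ε lam nu hat →
      ∃ l : Fin N → M.Dual, M.IsOptimalP3 G l ∧
        ∀ n, Filter.Tendsto (fun k => lam k n) Filter.atTop (𝓝 (l n)) := by
  obtain ⟨u, hu⟩ := hP2
  have hne := M.nonempty_feasible_of_isOptimalP2 hu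
  exact ⟨M.exists_isCCADMM G γ ε (M.exists_isMinOn_updateObjective G hne hN hG hc),
    fun _ _ _ h => h.exists_tendsto hne hN hG hP3 hc hγ.le hε₀.le hε₁⟩
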